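/- Let $F$ be a field and let $D$ be a central division algebra over $F$, that is, a division ring with center $F$ and $\dim_F D<\infty$. Then there exist $x,y\in D$ such that $F(xy-yx)$ is a maximal subfield of $D$. Here $F(c)$ denotes the smallest division subring of $D$ containing $F$ and $c$, and a maximal subfield of $D$ is a commutative division subring of $D$ that is not properly contained in any other commutative division subring of $D$. -/

import Mathlib

/-- A maximal subfield of a division ring `D`: a commutative division subring of `D` that is not
properly contained in any other commutative division subring of `D`. (Mathlib's `Subfield D`, for a
division ring `D`, is the type of division subrings of `D`; commutativity is not part of it.) -/
def IsMaximalSubfield {D : Type*} [DivisionRing D] (K : Subfield D) : Prop :=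
  Maximal (fun L : Subfield D => ∀ a ∈ L, ∀ b ∈ L, a * b = b * a) K

/-- `F(c)`: the smallest division subring of `D` containing (the image of) `F` and `c`. -/
def fieldAdjoin (F : Type*) {D : Type*} [Field F] [DivisionRing D] [Algebra F D] (c : D) :
    Subfield D :=
  Subfield.closure (Set.range (algebraMap F D) ∪ {c})

open Module
open scoped Matrix

/-! If `F` is finite, Wedderburn's little theorem gives `D = F`. Otherwise fix a self-centralizing
subfield `K`. Since `[K:F]² = [D:F]`, all such subfields share a degree `n`. It suffices that some
commutator `c` has `1, c, …, c ^ (n - 1)` independent over `F`: a commutative `L ⊇ F(c)` lies in a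
self-centralizing field of degree `n`, which these powers span. To find `c`, use
`exists_basis_rightMul`: right multiplications by an `F`-basis of `D` form a `K`-basis of `End_K D ≅
M_n(K)`. Cyclicity of a vector is the nonvanishing of a polynomial in the coordinates; explicit
matrices show that it is not zero, so it is nonzero at some `F`-point. -/

/-- If `b` is linearly independent over the center of a division ring, then the maps
`x ↦ a * x * b i` are left linearly independent. -/
theorem eq_zero_of_forall_sum_mul_mul_eq_zero {F D ι : Type*} [Field F] [DivisionRing D]
    [Algebra F D] [Algebra.IsCentral F D] {b : ι → D} (hb : LinearIndependent F b)
    (s : Finset ι) (a : ι → D) (h : ∀ x, ∑ i ∈ s, a i * x * b i = 0) : ∀ i ∈ s, a i = 0 := by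
  classical
  induction s using Finset.induction_on generalizing a with
  | empty => simp
  | insert j t hj ih =>
    by_cases haj : a j = 0
    · have := ih a fun x => by simpa [Finset.sum_insert hj, haj] using h x
      simpa [haj] using this
    · exfalso
      have h' (x : D) : x * b j + ∑ i ∈ t, (a j)⁻¹ * a i * x * b i = 0 := by
        have := congrArg ((a j)⁻¹ * ·) (h x)
        simpa [Finset.sum_insert hj, mul_add, Finset.mul_sum, ← mul_assoc, haj] using this
      -- Comparing `d` times the relation at `x` with the relation at `d * x` cancels the `j` term,
      -- so induction makes the normalised coefficients central.
      have hc (d : D) : ∀ i ∈ t, d * ((a j)⁻¹ * a i) - (a j)⁻¹ * a i * d = 0 := by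
        refine ih _ fun x => ?_
        have h1 := congrArg (d * ·) (h' x)
        have h2 := h' (d * x)
        simp only [mul_add, Finset.mul_sum, mul_zero] at h1
        simp only [sub_mul, Finset.sum_sub_distrib, mul_assoc] at h1 h2 ⊢
        exact sub_eq_zero.2 (add_left_cancel (h1.trans h2.symm))
      have hF (i : ι) (hi : i ∈ t) : ∃ r : F, algebraMap F D r = (a j)⁻¹ * a i := by
        have : (a j)⁻¹ * a i ∈ Subalgebra.center F D :=
          Subalgebra.mem_center_iff.2 fun d => sub_eq_zero.1 (hc d i hi)
        rwa [Algebra.IsCentral.center_eq_bot, Algebra.mem_bot] at this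
      choose! r hr using hF
      have hsum : ∑ i ∈ insert j t, (if i = j then 1 else r i) • b i = 0 := by
        rw [Finset.sum_insert hj, ← h' 1]
        congr 1
        · simp
        · refine Finset.sum_congr rfl fun i hi => ?_
          rw [if_neg (by rintro rfl; exact hj hi), Algebra.smul_def, hr i hi, mul_one]
      simpa using linearIndependent_iff'.1 hb _ _ hsum j (Finset.mem_insert_self j t)

/-- Every linear endomorphism of a finite-dimensional central division algebra is a combination
of left and right multiplications. -/
theorem exists_forall_eq_sum_mul_mul {F D ι : Type*} [Field F] [DivisionRing D]
    [Algebra F D] [Algebra.IsCentral F D] [FiniteDimensional F D] [Fintype ι]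
    (b : Basis ι F D) (f : D →ₗ[F] D) : ∃ a : ι → D, ∀ x, f x = ∑ i, a i * x * b i := by
  let φ : (ι → D) →ₗ[F] (D →ₗ[F] D) :=
    { toFun := fun a => ∑ i, LinearMap.mulRight F (b i) ∘ₗ LinearMap.mulLeft F (a i)
      map_add' := fun a a' => by ext x; simp [add_mul, Finset.sum_add_distrib]
      map_smul' := fun r a => by ext x; simp [Finset.smul_sum] }
  have hφ (a : ι → D) (x : D) : φ a x = ∑ i, a i * x * b i := by simp [φ]
  have hinj : Function.Injective φ := by
    rw [← LinearMap.ker_eq_bot, LinearMap.ker_eq_bot']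
    intro a ha
    funext i
    exact eq_zero_of_forall_sum_mul_mul_eq_zero b.linearIndependent Finset.univ a
      (fun x => by rw [← hφ, ha, LinearMap.zero_apply]) i (Finset.mem_univ i)
  have hsurj : Function.Surjective φ :=
    (LinearMap.injective_iff_surjective_of_finrank_eq_finrank (by
      rw [finrank_pi_fintype, finrank_linearMap]
      simp [finrank_eq_card_basis b])).1 hinj
  obtain ⟨a, rfl⟩ := hsurj f
  exact ⟨a, hφ a⟩

/-! ### Self-centralizing subfields and their degree -/

section SelfCentralizing

variable {F K D ι : Type*} [Field F] [Field K] [DivisionRing D] [Algebra F D] [Algebra F K]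
  [Algebra.IsCentral F D] [FiniteDimensional F D] [Module K D] [IsScalarTower F K D]
  [IsScalarTower K D D] [Fintype ι]

/-- Right multiplication as a linear map over a field acting from the left. -/
def rightMul (K : Type*) {D : Type*} [Field K] [DivisionRing D] [Module K D]
    [IsScalarTower K D D] (d : D) : Module.End K D where
  toFun x := x * d
  map_add' x y := add_mul x y d
  map_smul' k x := smul_mul_assoc k x d

@[simp] theorem rightMul_apply (d x : D) : rightMul K d x = x * d := rfl

/-- If `K` is its own centralizer in `D`, then right multiplications by an `F`-basis of `D` form a
`K`-basis of `End_K D`. -/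
theorem exists_basis_rightMul (hK : ∀ a : D, (∀ k : K, a * (k • 1) = k • a) → ∃ k : K, k • 1 = a)
    (b : Basis ι F D) : ∃ B : Basis ι K (Module.End K D), ∀ i, B i = rightMul K (b i) := by
  have hli : LinearIndependent K fun i => rightMul K (b i) := by
    rw [Fintype.linearIndependent_iff]
    intro g hg i
    have := eq_zero_of_forall_sum_mul_mul_eq_zero b.linearIndependent Finset.univ
      (fun i => g i • (1 : D)) (fun x => by
        have := LinearMap.congr_fun hg x
        simpa [smul_mul_assoc] using this) i (Finset.mem_univ i)
    simpa using this
  refine ⟨Basis.mk hli fun f _ => ?_, fun i => by simp⟩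
  obtain ⟨a, ha⟩ := exists_forall_eq_sum_mul_mul b (f.restrictScalars F)
  simp only [LinearMap.coe_restrictScalars] at ha
  -- Expanding `f (k • x) = k • f x` and using uniqueness of coefficients.
  have hcomm (i : ι) (k : K) : a i * (k • 1) = k • a i := by
    refine sub_eq_zero.1 (eq_zero_of_forall_sum_mul_mul_eq_zero b.linearIndependent Finset.univ
      (fun i => a i * (k • 1) - k • a i) (fun x => ?_) i (Finset.mem_univ i))
    have h := f.map_smul k x
    rw [ha, ha, Finset.smul_sum, ← sub_eq_zero, ← Finset.sum_sub_distrib] at h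
    rw [← h]
    refine Finset.sum_congr rfl fun i _ => ?_
    simp only [sub_mul, smul_mul_assoc, mul_assoc, one_mul]
  choose k hk using fun i => hK (a i) (hcomm i)
  have : f = ∑ i, k i • rightMul K (b i) := by
    ext x
    simp [ha x, ← hk, smul_mul_assoc]
  rw [this]
  exact Submodule.sum_mem _ fun i _ => Submodule.smul_mem _ _ (Submodule.subset_span ⟨i, rfl⟩)

/-- Counts the `K`-dimension of `End_K D` twice. -/
theorem finrank_eq_sq_of_selfCentralizing
    (hK : ∀ a : D, (∀ k : K, a * (k • 1) = k • a) → ∃ k : K, k • 1 = a) :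
    finrank F D = finrank K D ^ 2 := by
  obtain ⟨B, -⟩ := exists_basis_rightMul hK (finBasis F D)
  have : Module.Finite K D := Module.Finite.of_restrictScalars_finite F K D
  have h := finrank_eq_card_basis B
  rw [finrank_linearMap, Fintype.card_fin] at h
  rw [← h, sq]

theorem finrank_eq_finrank_of_selfCentralizing
    (hK : ∀ a : D, (∀ k : K, a * (k • 1) = k • a) → ∃ k : K, k • 1 = a) :
    finrank F K = finrank K D := by
  have h := finrank_eq_sq_of_selfCentralizing (F := F) hK
  have : Module.Finite K D := Module.Finite.of_restrictScalars_finite F K D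
  rw [← finrank_mul_finrank F K D, sq] at h
  exact Nat.eq_of_mul_eq_mul_right finrank_pos h

end SelfCentralizing

/-! ### Commutators with a cyclic vector -/

/-- Over any field there is a commutator of matrices with a cyclic vector. -/
theorem exists_commutator_det_ne_zero (K : Type*) [Field K] (n : ℕ) :
    ∃ A B : Matrix (Fin (n + 1)) (Fin (n + 1)) K,
      (Matrix.of fun j : Fin (n + 1) => (A * B - B * A) ^ (j : ℕ) *ᵥ Pi.single 0 1).det ≠ 0 := by
  -- Neighbouring diagonal entries differ in every characteristic, so the commutator with the shift
  -- `B` is a shift with nonzero weights.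
  let d : ℕ → K := fun j => if Even j then 0 else 1
  let A : Matrix (Fin (n + 1)) (Fin (n + 1)) K := Matrix.diagonal fun i => d i
  let B : Matrix (Fin (n + 1)) (Fin (n + 1)) K :=
    Matrix.of fun i j => if (i : ℕ) = j + 1 then 1 else 0
  have hd (j : ℕ) : d (j + 1) - d j ≠ 0 := by
    by_cases h : Even j <;> simp [d, Nat.even_add_one, h]
  have hC (j : ℕ) (hj : j + 1 < n + 1) :
      (A * B - B * A) *ᵥ Pi.single ⟨j, by omega⟩ 1 =
        (d (j + 1) - d j) • Pi.single ⟨j + 1, hj⟩ 1 := by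
    ext i
    by_cases hi : i = ⟨j + 1, hj⟩
    · subst hi
      simp [A, B]
    · have hi' : (i : ℕ) ≠ j + 1 := fun h => hi (Fin.ext h)
      simp [A, B, hi, hi']
  have hpow (j : ℕ) (hj : j < n + 1) : ∃ u : K, u ≠ 0 ∧
      (A * B - B * A) ^ j *ᵥ Pi.single 0 1 = u • Pi.single (⟨j, hj⟩ : Fin (n + 1)) 1 := by
    induction j with
    | zero => exact ⟨1, one_ne_zero, by
        rw [pow_zero, Matrix.one_mulVec, one_smul]; rfl⟩
    | succ j ih =>
      obtain ⟨u, hu, h⟩ := ih (by omega)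
      refine ⟨u * (d (j + 1) - d j), mul_ne_zero hu (hd j), ?_⟩
      rw [pow_succ', ← Matrix.mulVec_mulVec, h, Matrix.mulVec_smul, hC j hj, smul_smul]
  refine ⟨A, B, ?_⟩
  choose u hu hpow using fun j : Fin (n + 1) => hpow j j.2
  have : (Matrix.of fun j : Fin (n + 1) => (A * B - B * A) ^ (j : ℕ) *ᵥ Pi.single 0 1) =
      Matrix.diagonal u := by
    ext j i
    simp only [Matrix.of_apply, hpow, Matrix.diagonal_apply, Pi.smul_apply, Pi.single_apply,
      smul_eq_mul, mul_ite, mul_one, mul_zero, Fin.eta]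
    simp [eq_comm]
  rw [this, Matrix.det_diagonal]
  exact Finset.prod_ne_zero_iff.2 fun i _ => hu i

/-- If matrices `M i` span the matrix algebra over `K`, some commutator of combinations of the `M i`
with coefficients in an infinite subfield `F` has a cyclic vector. -/
theorem exists_combination_commutator_det_ne_zero {F K ι : Type*} [Field F] [Infinite F] [Field K]
    [Algebra F K] [Fintype ι] {n : ℕ} (M : ι → Matrix (Fin (n + 1)) (Fin (n + 1)) K)
    (hM : ⊤ ≤ Submodule.span K (Set.range M)) :
    ∃ X Y : ι → F, (Matrix.of fun j : Fin (n + 1) =>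
      ((∑ i, algebraMap F K (X i) • M i) * (∑ i, algebraMap F K (Y i) • M i) -
        (∑ i, algebraMap F K (Y i) • M i) * (∑ i, algebraMap F K (X i) • M i)) ^ (j : ℕ) *ᵥ
          Pi.single 0 1).det ≠ 0 := by
  let R := MvPolynomial (ι ⊕ ι) K
  let G (e : ι → ι ⊕ ι) : Matrix (Fin (n + 1)) (Fin (n + 1)) R :=
    ∑ i, (MvPolynomial.X (e i) : R) • (M i).map MvPolynomial.C
  -- The cyclicity determinant for two generic combinations of the `M i`.
  let P : R := (Matrix.of fun j : Fin (n + 1) =>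
    (G Sum.inl * G Sum.inr - G Sum.inr * G Sum.inl) ^ (j : ℕ) *ᵥ Pi.single 0 1).det
  have hG (s : ι ⊕ ι → K) (e : ι → ι ⊕ ι) :
      (MvPolynomial.eval s).mapMatrix (G e) = ∑ i, s (e i) • M i := by
    ext p q
    simp [G, Matrix.sum_apply]
  have hP (s : ι ⊕ ι → K) : MvPolynomial.eval s P = (Matrix.of fun j : Fin (n + 1) =>
      ((∑ i, s (.inl i) • M i) * (∑ i, s (.inr i) • M i) -
        (∑ i, s (.inr i) • M i) * (∑ i, s (.inl i) • M i)) ^ (j : ℕ) *ᵥ Pi.single 0 1).det := by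
    have hvec (N : Matrix (Fin (n + 1)) (Fin (n + 1)) R) (j : ℕ) (p : Fin (n + 1)) :
        MvPolynomial.eval s ((N ^ j *ᵥ Pi.single 0 1) p) =
          ((MvPolynomial.eval s).mapMatrix N ^ j *ᵥ Pi.single 0 1) p := by
      rw [← map_pow]
      simp
    rw [← hG s Sum.inl, ← hG s Sum.inr, ← map_mul, ← map_mul, ← map_sub, RingHom.map_det]
    congr 1
    ext j p
    exact hvec _ j p
  by_contra! hcon
  have hP0 : P = 0 := by
    refine MvPolynomial.funext_set (fun _ => Set.range (algebraMap F K))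
      (fun _ => Set.infinite_range_of_injective (algebraMap F K).injective) fun s hs => ?_
    choose t ht using fun i => hs i (Set.mem_univ i)
    rw [hP, map_zero]
    simp only [← ht]
    exact hcon (fun i => t (.inl i)) (fun i => t (.inr i))
  obtain ⟨A, B, hAB⟩ := exists_commutator_det_ne_zero K n
  obtain ⟨x, rfl⟩ := (Submodule.mem_span_range_iff_exists_fun K).1 (hM (Submodule.mem_top (x := A)))
  obtain ⟨y, rfl⟩ := (Submodule.mem_span_range_iff_exists_fun K).1 (hM (Submodule.mem_top (x := B)))
  apply hAB
  have := hP (Sum.elim x y)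
  rw [hP0, map_zero] at this
  simpa using this.symm

/-- Over an infinite center, some commutator has linearly independent powers up to the dimension
of `D` over a self-centralizing subfield. -/
theorem exists_commutator_linearIndependent_pow {F K D : Type*} [Field F] [Infinite F] [Field K]
    [DivisionRing D] [Algebra F D] [Algebra F K] [Algebra.IsCentral F D] [FiniteDimensional F D]
    [Module K D] [IsScalarTower F K D] [IsScalarTower K D D]
    (hK : ∀ a : D, (∀ k : K, a * (k • 1) = k • a) → ∃ k : K, k • 1 = a) :
    ∃ x y : D, LinearIndependent F fun j : Fin (finrank K D) => (x * y - y * x) ^ (j : ℕ) := by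
  have : Module.Finite K D := Module.Finite.of_restrictScalars_finite F K D
  obtain ⟨n, hn⟩ := Nat.exists_eq_succ_of_ne_zero (finrank_pos (R := K) (M := D)).ne'
  rw [hn]
  let e : Basis (Fin (n + 1)) K D := finBasisOfFinrankEq K D hn
  let b := finBasis F D
  obtain ⟨B, hB⟩ := exists_basis_rightMul hK b
  let T := LinearMap.toMatrixAlgEquiv e
  obtain ⟨X, Y, hXY⟩ := exists_combination_commutator_det_ne_zero (F := F)
    (fun i => T (B i)) (B.map T.toLinearEquiv).span_eq.ge
  have hT (X : Fin (finrank F D) → F) :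
      ∑ i, algebraMap F K (X i) • T (B i) = T (rightMul K (∑ i, X i • b i)) := by
    simp only [← map_smul, ← map_sum]
    congr 1
    ext x
    simp [hB, Finset.mul_sum]
  -- Right multiplication reverses products, hence the swap of `X` and `Y`.
  let x := ∑ i, Y i • b i
  let y := ∑ i, X i • b i
  refine ⟨x, y, ?_⟩
  have hc : rightMul K y * rightMul K x - rightMul K x * rightMul K y =
      rightMul K (x * y - y * x) := by
    ext z
    simp [mul_sub, mul_assoc]
  have hpow (c z : D) (j : ℕ) : (rightMul K c ^ j) z = z * c ^ j := by
    induction j generalizing z with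
    | zero => simp
    | succ j ih => rw [pow_succ, Module.End.mul_apply, ih, rightMul_apply, mul_assoc, pow_succ']
  rw [hT, hT, ← map_mul, ← map_mul, ← map_sub, hc] at hXY
  have hli := (Matrix.linearIndependent_rows_of_det_ne_zero hXY).restrict_scalars (R := F)
    (fun r s h => (algebraMap F K).injective (by simpa [Algebra.smul_def] using h))
  -- `ψ` sends `c ^ j` to the coordinates of `e 0 * c ^ j`, row `j` of the matrix.
  let ψ : D →ₗ[F] (Fin (n + 1) → K) :=
    (e.equivFun.toLinearMap.restrictScalars F) ∘ₗ LinearMap.mulLeft F (e 0)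
  refine LinearIndependent.of_comp ψ ?_
  convert hli using 1
  funext j
  have : (Pi.single 0 1 : Fin (n + 1) → K) = e.repr (e 0) := by
    simp [Finsupp.single_eq_pi_single]
  simp only [this, ← map_pow]
  refine .trans ?_ (LinearMap.toMatrix_mulVec_repr e e _ (e 0)).symm
  rw [hpow]
  rfl

/-! ### Self-centralizing subalgebras -/

/-- A commutative subalgebra of a finite-dimensional algebra lies in a self-centralizing one. -/
theorem exists_le_eq_centralizer {F D : Type*} [Field F] [Ring D] [Algebra F D]
    [FiniteDimensional F D] (A : Subalgebra F D) (hA : A ≤ Subalgebra.centralizer F (A : Set D)) :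
    ∃ B : Subalgebra F D, A ≤ B ∧ B = Subalgebra.centralizer F (B : Set D) := by
  have hwf : WellFoundedGT (Subalgebra F D) :=
    (Subalgebra.toSubmodule : Subalgebra F D ↪o Submodule F D).wellFoundedGT
  obtain ⟨B, hAB, hB⟩ := exists_maximal_ge_of_wellFoundedGT
    (fun B : Subalgebra F D => B ≤ Subalgebra.centralizer F (B : Set D)) A hA
  refine ⟨B, hAB, hB.prop.antisymm fun x hx => ?_⟩
  -- Adjoining `x` to `B` keeps it commutative, so maximality puts `x` in `B`.
  have hS : insert x (B : Set D) ⊆ Subalgebra.centralizer F (insert x (B : Set D)) := by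
    rw [Subalgebra.mem_centralizer_iff] at hx
    rintro u hu
    rw [SetLike.mem_coe, Subalgebra.mem_centralizer_iff]
    rintro v hv
    rcases hu with rfl | hu <;> rcases hv with rfl | hv
    · rfl
    · exact hx v hv
    · exact (hx u hu).symm
    · exact Subalgebra.mem_centralizer_iff F |>.1 (hB.prop hu) v hv
  have hle := hB.le_of_ge (y := Algebra.adjoin F (insert x (B : Set D)))
    ((Algebra.adjoin_le_centralizer_centralizer F _).trans
      (Subalgebra.centralizer_le F _ _ (Algebra.adjoin_le hS)))
    (fun u hu => Algebra.subset_adjoin (Set.mem_insert_of_mem x hu))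
  exact hle (Algebra.subset_adjoin (Set.mem_insert x _))

section CentralizerField

variable {F D : Type*} [Field F] [DivisionRing D] [Algebra F D]

/-- A self-centralizing subalgebra of a division algebra is a field. -/
noncomputable abbrev fieldOfEqCentralizer (A : Subalgebra F D)
    (hA : A = Subalgebra.centralizer F (A : Set D)) : Field A := by
  classical
  exact
  { A.toRing with
    mul_comm := fun a b => Subtype.ext
      ((Subalgebra.mem_centralizer_iff F).1 (hA.le b.2) a a.2)
    inv := fun a => ⟨(a : D)⁻¹, hA.ge ((Subalgebra.mem_centralizer_iff F).2 fun g hg =>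
      (Commute.inv_right₀ (show Commute g (a : D) from
        (Subalgebra.mem_centralizer_iff F).1 (hA.le a.2) g hg)).eq)⟩
    exists_pair_ne := ⟨0, 1, zero_ne_one⟩
    mul_inv_cancel := fun a ha => Subtype.ext (mul_inv_cancel₀ (by simpa using ha))
    inv_zero := Subtype.ext inv_zero
    nnqsmul := _
    nnqsmul_def := fun _ _ => rfl
    qsmul := _
    qsmul_def := fun _ _ => rfl }

theorem exists_smul_one_eq_of_eq_centralizer (A : Subalgebra F D)
    (hA : A = Subalgebra.centralizer F (A : Set D)) (a : D)
    (ha : ∀ k : A, a * (k • (1 : D)) = k • a) : ∃ k : A, k • (1 : D) = a := by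
  refine ⟨⟨a, hA.ge ((Subalgebra.mem_centralizer_iff F).2 fun g hg => ?_)⟩, by
    simp [Subalgebra.smul_def]⟩
  simpa [Subalgebra.smul_def] using (ha ⟨g, hg⟩).symm

variable [Algebra.IsCentral F D] [FiniteDimensional F D]

theorem finrank_sq_of_eq_centralizer (A : Subalgebra F D)
    (hA : A = Subalgebra.centralizer F (A : Set D)) : finrank F A ^ 2 = finrank F D := by
  let _ := fieldOfEqCentralizer A hA
  have h := exists_smul_one_eq_of_eq_centralizer A hA
  rw [finrank_eq_sq_of_selfCentralizing (F := F) h, finrank_eq_finrank_of_selfCentralizing h]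

theorem exists_commutator_linearIndependent_pow_of_eq_centralizer [Infinite F] (A : Subalgebra F D)
    (hA : A = Subalgebra.centralizer F (A : Set D)) :
    ∃ x y : D, LinearIndependent F fun j : Fin (finrank F A) => (x * y - y * x) ^ (j : ℕ) := by
  let _ := fieldOfEqCentralizer A hA
  have h := exists_smul_one_eq_of_eq_centralizer A hA
  rw [finrank_eq_finrank_of_selfCentralizing (F := F) h]
  exact exists_commutator_linearIndependent_pow h

end CentralizerField

/-! ### The division subring `F(c)` -/

section FieldAdjoin

variable {F D : Type*} [Field F] [DivisionRing D] [Algebra F D]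

theorem algebraMap_mem_fieldAdjoin (c : D) (r : F) : algebraMap F D r ∈ fieldAdjoin F c :=
  Subfield.subset_closure (Or.inl ⟨r, rfl⟩)

theorem mem_fieldAdjoin_self (c : D) : c ∈ fieldAdjoin F c :=
  Subfield.subset_closure (Or.inr rfl)

/-- The centralizer of a subset of a division ring, as a division subring. -/
def Subfield.centralizerOf (S : Set D) : Subfield D where
  __ := Subring.centralizer S
  inv_mem' x hx g hg := (Commute.inv_right₀ (show Commute g x from hx g hg)).eq

theorem commute_of_mem_fieldAdjoin (c : D) :
    ∀ a ∈ fieldAdjoin F c, ∀ b ∈ fieldAdjoin F c, a * b = b * a := by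
  let S : Set D := Set.range (algebraMap F D) ∪ {c}
  have h1 : fieldAdjoin F c ≤ Subfield.centralizerOf S := by
    refine Subfield.closure_le.2 ?_
    rintro u (⟨r, rfl⟩ | rfl) v (⟨s, rfl⟩ | rfl)
    · exact Algebra.commutes s _
    · exact (Algebra.commutes r _).symm
    · exact Algebra.commutes s _
    · rfl
  have h2 : fieldAdjoin F c ≤ Subfield.centralizerOf (fieldAdjoin F c : Set D) :=
    Subfield.closure_le.2 fun u hu v hv => (h1 hv u hu).symm
  exact fun a ha b hb => h2 hb a ha

/-- A division subring containing the base field, as a subalgebra. -/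
def Subfield.toSubalgebraOf (L : Subfield D) (hL : ∀ r : F, algebraMap F D r ∈ L) :
    Subalgebra F D where
  __ := L.toSubring
  algebraMap_mem' := hL

end FieldAdjoin

theorem theorem3p4 (F : Type*) (D : Type*) [Field F] [DivisionRing D] [Algebra F D]
    [Algebra.IsCentral F D] [FiniteDimensional F D] :
    ∃ x y : D, IsMaximalSubfield (fieldAdjoin F (x * y - y * x)) := by
  cases finite_or_infinite F with
  | inl hF =>
    have : Finite D := Module.finite_of_finite F
    have hcomm (a b : D) : a * b = b * a := (littleWedderburn D).mul_comm a b
    refine ⟨0, 0, commute_of_mem_fieldAdjoin _, fun L _ _ a _ => ?_⟩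
    have : a ∈ Subalgebra.center F D := Subalgebra.mem_center_iff.2 fun b => hcomm b a
    rw [Algebra.IsCentral.center_eq_bot, Algebra.mem_bot] at this
    obtain ⟨r, rfl⟩ := this
    exact algebraMap_mem_fieldAdjoin _ r
  | inr hF =>
    obtain ⟨A, -, hA⟩ := exists_le_eq_centralizer (⊥ : Subalgebra F D) fun u hu =>
      (Subalgebra.mem_centralizer_iff F).2 fun v _ => by
        obtain ⟨r, rfl⟩ := Algebra.mem_bot.1 hu
        exact (Algebra.commutes r v).symm
    obtain ⟨x, y, hxy⟩ := exists_commutator_linearIndependent_pow_of_eq_centralizer A hA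
    refine ⟨x, y, commute_of_mem_fieldAdjoin _, fun L hL hle a ha => ?_⟩
    set c := x * y - y * x
    obtain ⟨B, hLB, hB⟩ := exists_le_eq_centralizer
      (L.toSubalgebraOf (F := F) fun r => hle (algebraMap_mem_fieldAdjoin c r))
      fun u hu => (Subalgebra.mem_centralizer_iff F).2 fun v hv => hL v hv u hu
    have hdim : finrank F B = finrank F A := Nat.pow_left_injective two_ne_zero
      ((finrank_sq_of_eq_centralizer B hB).trans (finrank_sq_of_eq_centralizer A hA).symm)
    -- The independent powers of `c` lie in `B` and are as many as its dimension.
    have hspan : Submodule.span F (Set.range fun j : Fin (finrank F A) => c ^ (j : ℕ)) =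
        Subalgebra.toSubmodule B := by
      refine Submodule.eq_of_le_of_finrank_eq (Submodule.span_le.2 ?_) ?_
      · rintro _ ⟨j, rfl⟩
        exact B.pow_mem (hLB (hle (mem_fieldAdjoin_self c))) _
      · rw [finrank_span_eq_card hxy, Fintype.card_fin]
        exact hdim.symm
    have hE : Submodule.span F (Set.range fun j : Fin (finrank F A) => c ^ (j : ℕ)) ≤
        Subalgebra.toSubmodule ((fieldAdjoin F c).toSubalgebraOf (algebraMap_mem_fieldAdjoin c)) := by
      rw [Submodule.span_le]
      rintro _ ⟨j, rfl⟩
      exact pow_mem (mem_fieldAdjoin_self (F := F) c) _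
    exact hE (hspan.ge (hLB ha))
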